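/- Let $n\ge 1$, and let $\mathrm{Toep}_n\subset M_n(\mathbb C)$ be the operator system of $n\times n$ Toeplitz matrices $T=(t_{k-l})_{k,l}$, with the operator norm of $\mathbb C^n$. Let $D=\mathrm{diag}(1,\dots,n)$ be the truncated Dirac operator of the circle, and let $\partial A:=i[D,A]$ for $A\in\mathrm{Toep}_n$. The elements of the dual are written as Laurent polynomials $a(z)=\sum_{|k|<n}a_kz^k$ through the pairing $a(T)=\sum_k a_kt_{-k}$. In particular the constant $c\in\mathbb R$ is the functional $T\mapsto c\,t_0$, and $1$ is the normalized trace. Let $\partial^t$ be the transpose of $\partial$, $(\partial^t\Phi)(A)=\Phi(\partial A)$, and let $\|\cdot\|^*$ be the norm on the dual that is dual to the operator norm on $\mathrm{Toep}_n$. A functional is self-adjoint if it is real on self-adjoint Toeplitz matrices. The state space $\mathcal S$ is the set of positive linear functionals $\varphi$ on $\mathrm{Toep}_n$ with $\varphi(1)=1$. The Connes distance on $\mathcal S$ is $$d(\varphi,\psi)=\sup\{|\varphi(A)-\psi(A)| : A=A^*\in\mathrm{Toep}_n,\ \|[D,A]\|\le 1\}.$$ (i) Every $\varphi\in\mathcal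 S$ has a primitive modulo constants: there is a self-adjoint functional $\Phi$ with $\partial^t\Phi=\varphi-1$. For $\varphi,\psi\in\mathcal S$ and all self-adjoint functionals $\Phi,\Psi$ with $\partial^t\Psi-\partial^t\Phi=\psi-\varphi$ (in particular, for all self-adjoint $\Phi,\Psi$ with $\partial^t\Phi=\varphi-1$ and $\partial^t\Psi=\psi-1$), $$d(\varphi,\psi)=\inf_{c\in\mathbb R}\|\Psi-\Phi-c\|^*<\infty .$$ (ii) For every $\varphi\in\mathcal S$ the Laurent polynomial $\varphi(z)$ is non-negative on $|z|=1$, and $\mu_\varphi:=\varphi(e^{ix})\,\frac{dx}{2\pi}$ is a probability measure on $S^1=\mathbb R/2\pi\mathbb Z$. For $\varphi,\psi\in\mathcal S$, $$d(\varphi,\psi)\ \ge\ d_T(\mu_\varphi,\mu_\psi),$$ where $d_T(\mu,\nu)=\sup\{|\int f\,d\mu-\int f\,d\nu| : f:S^1\to\mathbb R \text{ is } 1\text{-Lipschitz for arc length}\}$ is the Kantorovich distance. The same bound holds for the explicit expression for the Kantorovich distance on the circle: $$d(\varphi,\psi)\ \ge\ \inf_{a\in\mathbb R}\int_0^{2\pi}|\alpha(x)-a|\,dx,\qquad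 \alpha(x)=\mu_\varphi([0,x])-\mu_\psi([0,x]).$$ -/

import Mathlib

open scoped Matrix.Norms.L2Operator ComplexOrder

noncomputable section

namespace TruncatedCircle

/-- The Toeplitz operator system: complex `n × n` matrices that are constant along diagonals. The
scoped norm on matrices is the operator norm on `ℂⁿ` with its Euclidean norm. -/
def Toep (n : ℕ) : Submodule ℂ (Matrix (Fin n) (Fin n) ℂ) where
  carrier := {A | ∀ i j k l : Fin n, (i : ℤ) - j = (k : ℤ) - l → A i j = A k l}
  add_mem' := by
    intro A B hA hB i j k l h
    simp [hA i j k l h, hB i j k l h]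
  zero_mem' := by
    intro i j k l _
    rfl
  smul_mem' := by
    intro c A hA i j k l h
    simp [hA i j k l h]

/-- The matrix with `1` on the diagonal `i - j = m` and `0` elsewhere. -/
def diag (n : ℕ) (m : ℤ) : Toep n :=
  ⟨Matrix.of fun i j => if (i : ℤ) - j = m then 1 else 0, by
    intro i j k l h
    simp [h]⟩

/-- The order unit: the identity matrix. -/
def unit (n : ℕ) : Toep n :=
  ⟨1, by
    intro i j k l h
    have h2 : i = j ↔ k = l := by
      rw [Fin.ext_iff, Fin.ext_iff]
      omega
    simp [Matrix.one_apply, h2]⟩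

/-- The truncated Dirac operator `P D P`, with `D e_k = k e_k` for `k = 1, …, n`. -/
def dirac (n : ℕ) : Matrix (Fin n) (Fin n) ℂ :=
  Matrix.diagonal fun i => ((i : ℕ) : ℂ) + 1

/-- The commutator `[D, A]`. -/
def comm {n : ℕ} (A : Matrix (Fin n) (Fin n) ℂ) : Matrix (Fin n) (Fin n) ℂ :=
  dirac n * A - A * dirac n

theorem comm_apply {n : ℕ} (A : Matrix (Fin n) (Fin n) ℂ) (i j : Fin n) :
    comm A i j = (((i : ℤ) - j : ℤ) : ℂ) * A i j := by
  simp only [comm, dirac, Matrix.sub_apply, Matrix.diagonal_mul, Matrix.mul_diagonal]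
  push_cast
  ring

/-- The derivation `∂ A = i [D, A]` on Toeplitz matrices. -/
def del (n : ℕ) : Toep n →L[ℂ] Toep n :=
  LinearMap.toContinuousLinearMap
    { toFun := fun A => ⟨Complex.I • comm (A : Matrix (Fin n) (Fin n) ℂ), by
        intro i j k l h
        simp only [Matrix.smul_apply, comm_apply, h, A.2 i j k l h]⟩
      map_add' := by
        intro A B
        ext i j
        simp only [comm, Submodule.coe_add, mul_add, add_mul, Matrix.smul_apply, Matrix.sub_apply,
          Matrix.add_apply, smul_eq_mul]
        ring
      map_smul' := by
        intro c A
        ext i j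
        simp only [comm_apply, Submodule.coe_smul, Matrix.smul_apply, smul_eq_mul,
          RingHom.id_apply]
        ring }

/-- The transpose `∂ᵗ`, acting on linear functionals on `Toep n`: `(∂ᵗ Φ)(A) = Φ (∂ A)`. -/
def delT {n : ℕ} (Φ : StrongDual ℂ (Toep n)) : StrongDual ℂ (Toep n) :=
  Φ.comp (del n)

/-- Self-adjoint functionals: those that are real on self-adjoint matrices. -/
def IsSelfAdjointFunctional {n : ℕ} (Φ : StrongDual ℂ (Toep n)) : Prop :=
  ∀ A : Toep n, (A : Matrix (Fin n) (Fin n) ℂ).IsHermitian → (Φ A).im = 0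

/-- States of the operator system `Toep n`: positive unital linear functionals. -/
def IsState {n : ℕ} (φ : StrongDual ℂ (Toep n)) : Prop :=
  (∀ A : Toep n, (A : Matrix (Fin n) (Fin n) ℂ).PosSemidef → 0 ≤ φ A) ∧ φ (unit n) = 1

/-- The `k`-th coefficient `a_k` of a functional, so that the functional is
`(t_{i-j}) ↦ ∑ₖ a_k t_{-k}`. -/
def coeff {n : ℕ} (φ : StrongDual ℂ (Toep n)) (k : ℤ) : ℂ :=
  φ (diag n (-k))

/-- The functional `(t_{i-j}) ↦ t_0` (the normalized trace): its coefficients are `a_0 = 1` and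
`a_k = 0` for `k ≠ 0`, so it is the constant function `1` among Laurent polynomials. -/
def one (n : ℕ) : StrongDual ℂ (Toep n) :=
  LinearMap.toContinuousLinearMap
    ((n : ℂ)⁻¹ • (Matrix.traceLinearMap (Fin n) ℂ ℂ ∘ₗ (Toep n).subtype))

/-- The Connes distance `sup {|φ(A) - ψ(A)| : A = Aᴴ ∈ Toep n, ‖[D, A]‖ ≤ 1}`. -/
def connesDist {n : ℕ} (φ ψ : StrongDual ℂ (Toep n)) : ENNReal :=
  ⨆ (A : Toep n) (_ : (A : Matrix (Fin n) (Fin n) ℂ).IsHermitian)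
    (_ : ‖comm (A : Matrix (Fin n) (Fin n) ℂ)‖ ≤ 1), ENNReal.ofReal ‖φ A - ψ A‖

/-- The circle `ℝ / 2πℤ`; its metric is the arc length distance. -/
abbrev S1 : Type := AddCircle (2 * Real.pi)

instance instFactTwoPiPos : Fact (0 < 2 * Real.pi) := ⟨Real.two_pi_pos⟩

/-- The Laurent polynomial `∑ₖ a_k zᵏ` of a functional, at `z = exp (i x)`. -/
def laurent {n : ℕ} (φ : StrongDual ℂ (Toep n)) (x : S1) : ℂ :=
  ∑ k ∈ Finset.Ioo (-(n : ℤ)) n, coeff φ k * fourier k x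

/-- The measure on the circle associated with a state: its density with respect to the normalized
Haar measure `dx / 2π` is the Laurent polynomial of the state. -/
def circleMeasure {n : ℕ} (φ : StrongDual ℂ (Toep n)) : MeasureTheory.Measure S1 :=
  (AddCircle.haarAddCircle (T := 2 * Real.pi)).withDensity
    fun x => ENNReal.ofReal (laurent φ x).re

/-- The Kantorovich distance of two probability measures on a compact metric space: the supremum of
`|∫ f dμ - ∫ f dν|` over all `1`-Lipschitz functions `f`. -/
def kantorovichDist {X : Type*} [MetricSpace X] [CompactSpace X] [MeasurableSpace X]
    [BorelSpace X] (μ ν : MeasureTheory.Measure X) : ENNReal :=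
  ⨆ (f : X → ℝ) (_ : LipschitzWith 1 f), ENNReal.ofReal |∫ x, f x ∂μ - ∫ x, f x ∂ν|

/-- The difference `α(x) = μ([0, x]) - ν([0, x])` of the distribution functions of two measures on
the circle, for `0 ≤ x ≤ 2π`. -/
def cdfDiff (μ ν : MeasureTheory.Measure S1) (x : ℝ) : ℝ :=
  μ.real ((fun t : ℝ => (t : S1)) '' Set.Icc 0 x) -
    ν.real ((fun t : ℝ => (t : S1)) '' Set.Icc 0 x)

end TruncatedCircle

end

/-! The derivation ∂ multiplies the entry at (k, l) by i(k - l). Its kernel on Toeplitz matrices is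
spanned by the unit, its range is the kernel of `one`, and division by i(k - l) inverts it there
(`del_integ`, `integ_del`). Composing a state with this inverse gives a primitive. If ∂ᵗΘ = ψ - φ,
then |φ(A) - ψ(A)| = |Θ(∂A)|, where ∂A runs over the self-adjoint matrices of norm at most 1 in the
kernel of `one`. The distance is therefore the norm of Θ on that kernel, which by Hahn–Banach is the
norm of Θ modulo multiples of `one` (`connesDist_eq`). Self-adjointness of Θ allows self-adjoint
matrices and real constants to suffice.

For the lower bounds, a function g on the circle is compressed to the Toeplitz matrix of its Fourier
coefficients. This does not increase the sup norm (`norm_toep_fourierCoeff_le`), and a state takes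
on it the value ∫ g dμ. A 1-Lipschitz f compresses to an admissible matrix, because the commutator
is a limit of compressed difference quotients. Dually, the L¹ norm of a self-adjoint Laurent
polynomial is at most its functional norm; applied to Θ - c, where Θ is up to a constant 2πα, this
gives the explicit bound. -/

noncomputable section

namespace TruncatedCircle

variable {n : ℕ}

/-! ### Toeplitz matrices and their coefficients -/

/-- The Toeplitz matrix with entries `c (i - j)`. -/
def toep (n : ℕ) (c : ℤ → ℂ) : Toep n :=
  ⟨Matrix.of fun i j => c ((i : ℤ) - j), by
    intro i j k l h
    simp [h]⟩

@[simp]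
theorem toep_apply (c : ℤ → ℂ) (i j : Fin n) :
    (toep n c : Matrix (Fin n) (Fin n) ℂ) i j = c ((i : ℤ) - j) := rfl

theorem toep_eq_sum (c : ℤ → ℂ) :
    toep n c = ∑ k ∈ Finset.Ioo (-(n : ℤ)) n, c (-k) • diag n (-k) := by
  ext i j
  rw [AddSubmonoidClass.coe_finsetSum, Matrix.sum_apply, Finset.sum_eq_single ((j : ℤ) - i)]
  · simp [diag]
  · intro k _ hk
    have : (i : ℤ) - j ≠ -k := by omega
    simp [diag, this]
  · intro h
    exact absurd (Finset.mem_Ioo.2 (by omega)) h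

theorem map_toep (φ : StrongDual ℂ (Toep n)) (c : ℤ → ℂ) :
    φ (toep n c) = ∑ k ∈ Finset.Ioo (-(n : ℤ)) n, coeff φ k * c (-k) := by
  simp only [toep_eq_sum, map_sum, map_smul, smul_eq_mul, coeff, mul_comm]

theorem isHermitian_toep {c : ℤ → ℂ} (h : ∀ k, star (c k) = c (-k)) :
    (toep n c : Matrix (Fin n) (Fin n) ℂ).IsHermitian := by
  ext i j
  simp only [Matrix.conjTranspose_apply, toep_apply, h, neg_sub]

theorem one_apply (A : Toep n) (i : Fin n) : one n A = (A : Matrix (Fin n) (Fin n) ℂ) i i := by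
  have hn : (n : ℂ) ≠ 0 := Nat.cast_ne_zero.2 i.pos.ne'
  have h : ∀ j : Fin n, (A : Matrix (Fin n) (Fin n) ℂ) j j = (A : Matrix (Fin n) (Fin n) ℂ) i i :=
    fun j => A.2 j j i i (by simp)
  simp [one, Matrix.trace, h, hn]

theorem one_unit (hn : 0 < n) : one n (unit n) = 1 := by
  rw [one_apply _ ⟨0, hn⟩]
  simp [unit]

theorem del_apply (A : Toep n) (i j : Fin n) :
    (del n A : Matrix (Fin n) (Fin n) ℂ) i j =
      Complex.I * ((((i : ℤ) - j : ℤ) : ℂ) * (A : Matrix (Fin n) (Fin n) ℂ) i j) := by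
  rw [← comm_apply]
  rfl

theorem norm_del (A : Toep n) : ‖del n A‖ = ‖comm (A : Matrix (Fin n) (Fin n) ℂ)‖ := by
  have : ‖del n A‖ = ‖Complex.I • comm (A : Matrix (Fin n) (Fin n) ℂ)‖ := rfl
  rw [this, norm_smul, Complex.norm_I, one_mul]

/-! ### Inverting the derivation -/

/-- The inverse of the derivation `∂` on matrices with vanishing diagonal. -/
def integ (n : ℕ) : Toep n →L[ℂ] Toep n :=
  LinearMap.toContinuousLinearMap
    { toFun := fun A => ⟨Matrix.of fun i j =>
          (A : Matrix (Fin n) (Fin n) ℂ) i j / (Complex.I * (((i : ℤ) - j : ℤ) : ℂ)), by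
        intro i j k l h
        simp only [Matrix.of_apply, h, A.2 i j k l h]⟩
      map_add' := by
        intro A B
        ext i j
        simp [add_div]
      map_smul' := by
        intro c A
        ext i j
        simp [mul_div_assoc] }

theorem integ_apply (A : Toep n) (i j : Fin n) :
    (integ n A : Matrix (Fin n) (Fin n) ℂ) i j =
      (A : Matrix (Fin n) (Fin n) ℂ) i j / (Complex.I * (((i : ℤ) - j : ℤ) : ℂ)) := rfl

/-- On the diagonal `integ` divides by zero and returns zero, so exactly the diagonal part of `A` is
lost. -/
theorem del_integ (A : Toep n) : del n (integ n A) = A - one n A • unit n := by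
  ext i j
  simp only [del_apply, integ_apply, one_apply A i, Submodule.coe_sub, Submodule.coe_smul,
    Matrix.sub_apply, Matrix.smul_apply, unit, Matrix.one_apply, smul_eq_mul]
  by_cases h : i = j
  · subst h
    simp
  · have h2 : (((i : ℤ) - j : ℤ) : ℂ) ≠ 0 := by
      rw [Int.cast_ne_zero]
      rw [Fin.ext_iff] at h
      omega
    have := Complex.I_ne_zero
    simp only [h, if_false]
    field_simp
    ring

theorem integ_del (A : Toep n) : integ n (del n A) = A - one n A • unit n := by
  rw [← del_integ]
  ext i j
  simp only [del_apply, integ_apply]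
  ring

theorem one_del (A : Toep n) : one n (del n A) = 0 := by
  rcases Nat.eq_zero_or_pos n with rfl | hn
  · simp [Subsingleton.elim A 0]
  · rw [one_apply _ ⟨0, hn⟩, del_apply]
    simp

theorem isHermitian_integ {A : Toep n} (hA : (A : Matrix (Fin n) (Fin n) ℂ).IsHermitian) :
    (integ n A : Matrix (Fin n) (Fin n) ℂ).IsHermitian := by
  ext i j
  rw [Matrix.conjTranspose_apply, integ_apply, integ_apply, star_div₀, hA.apply i j]
  congr 1
  simp only [star_mul', Complex.star_def, Complex.conj_I, map_intCast]
  push_cast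
  ring

/-! ### Self-adjointness of states and existence of primitives -/

theorem posSemidef_norm_add {A : Matrix (Fin n) (Fin n) ℂ} (hA : A.IsHermitian) :
    ((‖A‖ : ℂ) • (1 : Matrix (Fin n) (Fin n) ℂ) + A).PosSemidef := by
  open scoped MatrixOrder in
  rw [← Matrix.nonneg_iff_posSemidef]
  have h := IsSelfAdjoint.neg_algebraMap_norm_le_self (a := A) hA
  rw [neg_le_iff_add_nonneg, add_comm, Algebra.algebraMap_eq_smul_one] at h
  convert h using 2
  ext i j
  simp [Matrix.smul_apply]

/-- Adding ‖A‖ times the unit makes a Hermitian `A` positive and changes the value only by a real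
number. -/
theorem IsState.isSelfAdjointFunctional {φ : StrongDual ℂ (Toep n)} (hφ : IsState φ) :
    IsSelfAdjointFunctional φ := by
  intro A hA
  have h := hφ.1 ((‖(A : Matrix (Fin n) (Fin n) ℂ)‖ : ℂ) • unit n + A) (posSemidef_norm_add hA)
  rw [map_add, map_smul, hφ.2, smul_eq_mul, mul_one, Complex.nonneg_iff] at h
  simpa using h.2.symm

theorem IsState.exists_primitive {φ : StrongDual ℂ (Toep n)} (hφ : IsState φ) :
    ∃ Φ : StrongDual ℂ (Toep n), IsSelfAdjointFunctional Φ ∧ delT Φ = φ - one n := by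
  refine ⟨φ.comp (integ n), fun A hA => hφ.isSelfAdjointFunctional _ (isHermitian_integ hA), ?_⟩
  ext A
  change φ (integ n (del n A)) = φ A - one n A
  rw [integ_del, map_sub, map_smul, hφ.2, smul_eq_mul, mul_one]

theorem isSelfAdjointFunctional_one : IsSelfAdjointFunctional (one n) := by
  rcases Nat.eq_zero_or_pos n with rfl | hn
  · intro A _
    simp [Subsingleton.elim A 0]
  · intro A hA
    rw [one_apply _ ⟨0, hn⟩, ← Complex.conj_eq_iff_im]
    exact hA.apply _ _

theorem IsSelfAdjointFunctional.sub {Φ Ψ : StrongDual ℂ (Toep n)}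
    (hΦ : IsSelfAdjointFunctional Φ) (hΨ : IsSelfAdjointFunctional Ψ) :
    IsSelfAdjointFunctional (Φ - Ψ) := fun A hA => by
  simp [hΦ A hA, hΨ A hA]

theorem IsSelfAdjointFunctional.ofReal_smul {Φ : StrongDual ℂ (Toep n)}
    (hΦ : IsSelfAdjointFunctional Φ) (c : ℝ) : IsSelfAdjointFunctional ((c : ℂ) • Φ) :=
  fun A hA => by simp [hΦ A hA]

/-! ### Reduction to self-adjoint matrices -/

/-- The adjoint of a Toeplitz matrix. -/
def adj (A : Toep n) : Toep n :=
  ⟨(A : Matrix (Fin n) (Fin n) ℂ).conjTranspose, fun i j k l h => by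
    rw [Matrix.conjTranspose_apply, Matrix.conjTranspose_apply, A.2 j i l k (by omega)]⟩

theorem norm_adj (A : Toep n) : ‖adj A‖ = ‖A‖ :=
  Matrix.l2_opNorm_conjTranspose (A : Matrix (Fin n) (Fin n) ℂ)

theorem one_adj (A : Toep n) : one n (adj A) = star (one n A) := by
  rcases Nat.eq_zero_or_pos n with rfl | hn
  · rw [Subsingleton.elim (adj A) 0, Subsingleton.elim A 0, map_zero, star_zero]
  · rw [one_apply _ ⟨0, hn⟩, one_apply _ ⟨0, hn⟩]
    rfl

theorem IsSelfAdjointFunctional.map_adj {Θ : StrongDual ℂ (Toep n)}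
    (hΘ : IsSelfAdjointFunctional Θ) (A : Toep n) : Θ (adj A) = star (Θ A) := by
  have h1 := hΘ (A + adj A) (Matrix.isHermitian_add_transpose_self _)
  have h2 := hΘ (Complex.I • (A - adj A)) (by
    ext i j
    simp [adj]
    ring)
  simp only [map_add, map_smul, map_sub, smul_eq_mul, Complex.add_im, Complex.mul_im,
    Complex.I_re, Complex.I_im, Complex.sub_re] at h1 h2
  apply Complex.ext
  · simp; linarith
  · simp; linarith

/-- The absolute value of a self-adjoint functional at `A` is its value at a self-adjoint matrix
of norm at most `‖A‖`. -/
theorem IsSelfAdjointFunctional.exists_isHermitian {Θ : StrongDual ℂ (Toep n)}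
    (hΘ : IsSelfAdjointFunctional Θ) (A : Toep n) :
    ∃ B : Toep n, (B : Matrix (Fin n) (Fin n) ℂ).IsHermitian ∧ ‖B‖ ≤ ‖A‖ ∧
      Θ B = ‖Θ A‖ ∧ (one n A = 0 → one n B = 0) := by
  obtain ⟨u, hu, huA⟩ : ∃ u : ℂ, ‖u‖ = 1 ∧ u * Θ A = ‖Θ A‖ := by
    by_cases h : Θ A = 0
    · exact ⟨1, by simp, by simp [h]⟩
    · refine ⟨‖Θ A‖ / Θ A, by simp [h], by field_simp⟩
  -- The phase `u` makes the value at `u • A` real and non-negative, so passing to the Hermitian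
  -- part of `u • A` keeps it.
  refine ⟨(1 / 2 : ℂ) • (u • A + adj (u • A)), ?_, ?_, ?_, ?_⟩
  · ext i j
    simp [adj, add_comm]
  · rw [norm_smul]
    have := norm_add_le (u • A) (adj (u • A))
    rw [norm_adj, norm_smul, hu] at this
    rw [one_mul] at this
    rw [show ‖(1 / 2 : ℂ)‖ = 1 / 2 by norm_num]
    linarith
  · rw [map_smul, map_add, hΘ.map_adj, map_smul, smul_eq_mul, smul_eq_mul, huA]
    simp
    ring
  · intro h
    rw [map_smul, map_add, one_adj, map_smul, h]
    simp

/-! ### The Connes distance as a quotient norm -/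

theorem ofReal_norm_le_connesDist {φ ψ Θ : StrongDual ℂ (Toep n)} (h : delT Θ = ψ - φ)
    {B : Toep n} (hB : (B : Matrix (Fin n) (Fin n) ℂ).IsHermitian) (h0 : one n B = 0)
    (h1 : ‖B‖ ≤ 1) : ENNReal.ofReal ‖Θ B‖ ≤ connesDist φ ψ := by
  have hd : del n (integ n B) = B := by rw [del_integ, h0, zero_smul, sub_zero]
  refine le_iSup₂_of_le (integ n B) (isHermitian_integ hB) (le_iSup_of_le ?_ ?_)
  · rwa [← norm_del, hd]
  · refine ENNReal.ofReal_le_ofReal ?_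
    have : Θ (del n (integ n B)) = ψ (integ n B) - φ (integ n B) := DFunLike.congr_fun h _
    rw [hd] at this
    rw [this, norm_sub_rev]

/-- Since `one` vanishes on the range of ∂, the multiple of `one` does not affect Θ(∂A). -/
theorem connesDist_le {φ ψ Θ : StrongDual ℂ (Toep n)} (h : delT Θ = ψ - φ) (c : ℂ) :
    connesDist φ ψ ≤ ENNReal.ofReal ‖Θ - c • one n‖ := by
  refine iSup₂_le fun A _ => iSup_le fun hA => ENNReal.ofReal_le_ofReal ?_
  have h1 : (Θ - c • one n) (del n A) = ψ A - φ A := by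
    change Θ (del n A) - c * one n (del n A) = (ψ - φ) A
    rw [← h]
    change _ = Θ (del n A)
    rw [one_del, mul_zero, sub_zero]
  rw [norm_sub_rev, ← h1]
  rw [← norm_del] at hA
  calc _ ≤ ‖Θ - c • one n‖ * ‖del n A‖ := ContinuousLinearMap.le_opNorm _ _
    _ ≤ _ := mul_le_of_le_one_right (ContinuousLinearMap.opNorm_nonneg _) hA

/-- At a Hermitian matrix Θ and `one` are real, so the imaginary part of `c` contributes only to the
imaginary part of the value. -/
theorem IsSelfAdjointFunctional.norm_sub_re_le {Θ : StrongDual ℂ (Toep n)}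
    (hΘ : IsSelfAdjointFunctional Θ) (c : ℂ) :
    ‖Θ - (c.re : ℂ) • one n‖ ≤ ‖Θ - c • one n‖ := by
  refine ContinuousLinearMap.opNorm_le_bound _ (ContinuousLinearMap.opNorm_nonneg _) fun A => ?_
  obtain ⟨B, hB, hBA, hv, -⟩ :=
    (hΘ.sub (isSelfAdjointFunctional_one.ofReal_smul c.re)).exists_isHermitian A
  have h1 : ((Θ - c • one n) B).re = ‖(Θ - (c.re : ℂ) • one n) A‖ := by
    rw [← Complex.ofReal_re ‖(Θ - (c.re : ℂ) • one n) A‖, ← hv]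
    have := isSelfAdjointFunctional_one B hB
    simp [this]
  calc _ = ((Θ - c • one n) B).re := h1.symm
    _ ≤ ‖(Θ - c • one n) B‖ := Complex.re_le_norm _
    _ ≤ ‖Θ - c • one n‖ * ‖B‖ := ContinuousLinearMap.le_opNorm _ _
    _ ≤ _ := by gcongr

/-- A functional bounded by `M` on the kernel of `one` is, up to a multiple of `one`, bounded
by `M`. -/
theorem exists_norm_sub_smul_one_le (hn : 0 < n) (Θ : StrongDual ℂ (Toep n)) {M : ℝ} (hM : 0 ≤ M)
    (h : ∀ A : Toep n, one n A = 0 → ‖Θ A‖ ≤ M * ‖A‖) : ∃ c : ℂ, ‖Θ - c • one n‖ ≤ M := by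
  set W : Submodule ℂ (Toep n) := LinearMap.ker (one n).toLinearMap
  obtain ⟨g, hg, hgn⟩ := exists_extension_norm_eq W (Θ.comp W.subtypeL)
  have hgM : ‖g‖ ≤ M := by
    rw [hgn]
    exact ContinuousLinearMap.opNorm_le_bound _ hM fun A => h A A.2
  -- Θ - g vanishes on the kernel of `one`, hence is a multiple of `one`; its value at the unit is
  -- the factor.
  refine ⟨Θ (unit n) - g (unit n), ?_⟩
  convert hgM using 2
  ext A
  have hA : one n (A - one n A • unit n) = 0 := by
    rw [map_sub, map_smul, one_unit hn, smul_eq_mul, mul_one, sub_self]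
  have h1 : g (A - one n A • unit n) = Θ (A - one n A • unit n) := hg ⟨_, hA⟩
  rw [map_sub, map_sub, map_smul, map_smul, smul_eq_mul, smul_eq_mul] at h1
  change Θ A - (Θ (unit n) - g (unit n)) * one n A = g A
  linear_combination -h1

theorem connesDist_eq (hn : 0 < n) {φ ψ Θ : StrongDual ℂ (Toep n)}
    (hΘ : IsSelfAdjointFunctional Θ) (h : delT Θ = ψ - φ) :
    connesDist φ ψ = ENNReal.ofReal (⨅ c : ℝ, ‖Θ - (c : ℂ) • one n‖) := by
  have hfin : connesDist φ ψ ≠ ⊤ :=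
    ne_top_of_le_ne_top ENNReal.ofReal_ne_top (connesDist_le h 0)
  rw [← ENNReal.ofReal_toReal hfin]
  congr 1
  apply le_antisymm
  · exact le_ciInf fun c => ENNReal.toReal_le_of_le_ofReal (ContinuousLinearMap.opNorm_nonneg _) (connesDist_le h c)
  · obtain ⟨c, hc⟩ := exists_norm_sub_smul_one_le hn Θ (M := (connesDist φ ψ).toReal)
      ENNReal.toReal_nonneg fun A hA => by
        obtain ⟨B, hB, hBA, hv, h0⟩ := hΘ.exists_isHermitian A
        have hA' : ‖Θ A‖ = ‖Θ B‖ := by rw [hv, Complex.norm_real, norm_norm]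
        rw [hA']
        refine le_trans ?_ (mul_le_mul_of_nonneg_left hBA ENNReal.toReal_nonneg)
        rcases eq_or_ne B 0 with rfl | hB0
        · simp
        have hpos : 0 < ‖B‖ := norm_pos_iff.2 hB0
        have h1 := ofReal_norm_le_connesDist h (B := ((‖B‖⁻¹ : ℝ) : ℂ) • B)
          (by
            ext i j
            simp only [Submodule.coe_smul, Matrix.conjTranspose_apply, Matrix.smul_apply,
              smul_eq_mul, star_mul', hB.apply i j, Complex.star_def, Complex.conj_ofReal])
          (by rw [map_smul, h0 hA, smul_zero])
          (by
            rw [norm_smul, Complex.norm_real, norm_inv, norm_norm, inv_mul_cancel₀ hpos.ne'])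
        rw [ENNReal.ofReal_le_iff_le_toReal hfin, map_smul, norm_smul, Complex.norm_real,
          norm_inv, norm_norm, inv_mul_le_iff₀ hpos] at h1
        linarith
    exact (ciInf_le ⟨0, by rintro _ ⟨c, rfl⟩; exact ContinuousLinearMap.opNorm_nonneg _⟩ c.re).trans
      ((hΘ.norm_sub_re_le c).trans hc)

/-! ### Laurent polynomials and Toeplitz matrices of symbols -/

open MeasureTheory AddCircle Filter Topology

theorem continuous_fourier_apply (k : ℤ) : Continuous fun x : S1 => (fourier k x : ℂ) :=
  (fourier k).continuous

theorem continuous_laurent (φ : StrongDual ℂ (Toep n)) : Continuous (laurent φ) :=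
  continuous_finsetSum _ fun k _ => continuous_const.mul (continuous_fourier_apply k)

theorem laurent_eq (φ : StrongDual ℂ (Toep n)) (x : S1) :
    laurent φ x = φ (toep n fun k => fourier (-k) x) := by
  simp only [map_toep, neg_neg, laurent]

/-- By `laurent_eq`, evaluation of the Laurent polynomial at `x` is evaluation of the functional at
this rank-one matrix. -/
theorem posSemidef_toep_fourier (x : S1) :
    (toep n fun k => fourier (-k) x : Matrix (Fin n) (Fin n) ℂ).PosSemidef := by
  convert Matrix.posSemidef_vecMulVec_star_self (fun j : Fin n => (fourier (j : ℤ) x : ℂ)) using 1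
  ext i j
  rw [toep_apply, Matrix.vecMulVec_apply, Pi.star_apply, Complex.star_def, ← fourier_neg,
    ← fourier_add]
  congr 2
  ring

theorem IsState.laurent_nonneg {φ : StrongDual ℂ (Toep n)} (hφ : IsState φ) (x : S1) :
    0 ≤ laurent φ x := by
  rw [laurent_eq]
  exact hφ.1 _ (posSemidef_toep_fourier x)

theorem IsSelfAdjointFunctional.laurent_im {Θ : StrongDual ℂ (Toep n)}
    (hΘ : IsSelfAdjointFunctional Θ) (x : S1) : (laurent Θ x).im = 0 := by
  rw [laurent_eq]
  exact hΘ _ (posSemidef_toep_fourier x).1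

/-- The value of a functional at the Toeplitz matrix with symbol `g`. -/
theorem map_toep_fourierCoeff (φ : StrongDual ℂ (Toep n)) {g : S1 → ℂ}
    (hg : Integrable g haarAddCircle) :
    φ (toep n (fourierCoeff g)) = ∫ x, laurent φ x * g x ∂haarAddCircle := by
  have h : ∀ x, laurent φ x * g x =
      ∑ k ∈ Finset.Ioo (-(n : ℤ)) n, coeff φ k * (fourier k x • g x) := fun x => by
    rw [laurent, Finset.sum_mul]
    exact Finset.sum_congr rfl fun k _ => mul_assoc _ _ _
  simp only [h]
  rw [integral_finsetSum _ fun k _ => (hg.fourier_smul k).const_mul _, map_toep]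
  refine Finset.sum_congr rfl fun k _ => ?_
  rw [integral_const_mul, fourierCoeff, neg_neg]

/-! ### Contractivity of the compression and its L¹ dual -/

/-- The trigonometric polynomial with coefficients `v`. -/
def trigPoly (v : Fin n → ℂ) (x : S1) : ℂ := ∑ j : Fin n, v j * fourier (j : ℤ) x

theorem continuous_trigPoly (v : Fin n → ℂ) : Continuous (trigPoly v) :=
  continuous_finsetSum _ fun _ _ => continuous_const.mul (continuous_fourier_apply _)

/-- The Toeplitz matrix is the compression of multiplication by `g` to the span of the first `n`
characters. -/
theorem dotProduct_toep_fourierCoeff {g : S1 → ℂ} (hg : Integrable g haarAddCircle)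
    (v w : Fin n → ℂ) :
    star w ⬝ᵥ ((toep n (fourierCoeff g) : Matrix (Fin n) (Fin n) ℂ).mulVec v) =
      ∫ x, star (trigPoly w x) * trigPoly v x * g x ∂haarAddCircle := by
  have h : ∀ x : S1, star (trigPoly w x) * trigPoly v x * g x =
      ∑ i : Fin n, ∑ j : Fin n, star (w i) * v j * (fourier (-((i : ℤ) - j)) x • g x) := by
    intro x
    simp only [trigPoly, star_sum, star_mul']
    rw [Finset.sum_mul_sum, Finset.sum_mul]
    simp only [Finset.sum_mul]
    refine Finset.sum_congr rfl fun i _ => Finset.sum_congr rfl fun j _ => ?_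
    rw [neg_sub, sub_eq_add_neg, fourier_add, fourier_neg, smul_eq_mul]
    simp only [Complex.star_def]
    ring
  simp only [h]
  rw [integral_finsetSum]
  · simp only [dotProduct, Matrix.mulVec, toep_apply, Finset.mul_sum]
    refine Finset.sum_congr rfl fun i _ => ?_
    rw [integral_finsetSum]
    · refine Finset.sum_congr rfl fun j _ => ?_
      rw [integral_const_mul, Pi.star_apply, fourierCoeff]
      ring
    · exact fun j _ => (hg.fourier_smul _).const_mul _
  · exact fun i _ => integrable_finsetSum _ fun j _ => (hg.fourier_smul _).const_mul _

theorem fourierCoeff_one_eq (k : ℤ) :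
    fourierCoeff (fun _ : S1 => (1 : ℂ)) k = if k = 0 then 1 else 0 := by
  have : (fun _ : S1 => (1 : ℂ)) = fourier 0 := by
    ext x
    exact fourier_zero.symm
  rw [this, fourierCoeff_fourier, Pi.single_apply]

theorem toep_fourierCoeff_one : toep n (fourierCoeff fun _ : S1 => (1 : ℂ)) = unit n := by
  ext i j
  rw [toep_apply, fourierCoeff_one_eq]
  simp [unit, Matrix.one_apply, Fin.ext_iff, sub_eq_zero]

theorem integral_norm_sq_trigPoly (v : EuclideanSpace ℂ (Fin n)) :
    ∫ x, ‖trigPoly v x‖ ^ 2 ∂haarAddCircle = ‖v‖ ^ 2 := by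
  have h := dotProduct_toep_fourierCoeff (integrable_const (1 : ℂ)) v v
  rw [toep_fourierCoeff_one] at h
  have h1 : ∀ x : S1, star (trigPoly v x) * trigPoly v x * 1 = ((‖trigPoly v x‖ ^ 2 : ℝ) : ℂ) := by
    intro x
    rw [mul_one, Complex.star_def, Complex.conj_mul']
    push_cast
    rfl
  simp only [h1] at h
  rw [integral_complex_ofReal] at h
  apply Complex.ofReal_injective
  rw [← h, EuclideanSpace.norm_sq_eq]
  simp [unit, dotProduct, Complex.conj_mul']

/-- The Toeplitz matrix of a symbol bounded by `1` is a contraction. -/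
theorem norm_toep_fourierCoeff_le {g : S1 → ℂ} (hg : Integrable g haarAddCircle)
    (hg1 : ∀ x, ‖g x‖ ≤ 1) : ‖toep n (fourierCoeff g)‖ ≤ 1 := by
  change ‖(toep n (fourierCoeff g) : Matrix (Fin n) (Fin n) ℂ)‖ ≤ 1
  rw [Matrix.l2_opNorm_def]
  refine ContinuousLinearMap.opNorm_le_bound _ zero_le_one fun v => ?_
  set T : Matrix (Fin n) (Fin n) ℂ := (toep n (fourierCoeff g) : Matrix (Fin n) (Fin n) ℂ)
  set w : EuclideanSpace ℂ (Fin n) := WithLp.toLp 2 (T.mulVec v) with hw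
  change ‖w‖ ≤ 1 * ‖v‖
  have hv2 := integral_norm_sq_trigPoly v
  have hw2 := integral_norm_sq_trigPoly w
  have hint : ∀ u : EuclideanSpace ℂ (Fin n),
      Integrable (fun x : S1 => ‖trigPoly u x‖ ^ 2) haarAddCircle := fun u =>
    ((continuous_trigPoly u).norm.pow 2).integrable_of_hasCompactSupport
      (HasCompactSupport.of_compactSpace _)
  have h := dotProduct_toep_fourierCoeff hg v w
  have hnorm : ‖star (w : Fin n → ℂ) ⬝ᵥ T.mulVec v‖ = ‖w‖ ^ 2 := by
    have : star (w : Fin n → ℂ) ⬝ᵥ T.mulVec v = ((‖w‖ ^ 2 : ℝ) : ℂ) := by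
      rw [EuclideanSpace.norm_sq_eq, dotProduct]
      push_cast
      refine Finset.sum_congr rfl fun i _ => ?_
      rw [Pi.star_apply, Complex.star_def, ← Complex.conj_mul']
    rw [this, Complex.norm_real, Real.norm_of_nonneg (sq_nonneg _)]
  -- Testing against w = Tv and using ab ≤ (a² + b²)/2 under the integral, with Parseval, gives ‖w‖
  -- ≤ ‖v‖.
  have hle : ‖w‖ ^ 2 ≤ (‖w‖ ^ 2 + ‖v‖ ^ 2) / 2 := by
    conv_lhs => rw [← hnorm, h]
    rw [← hv2, ← hw2, ← integral_add (hint _) (hint _), ← integral_div]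
    refine norm_integral_le_of_norm_le (((hint _).add (hint _)).div_const 2)
      (Filter.Eventually.of_forall fun x => ?_)
    rw [norm_mul, norm_mul, norm_star]
    have h3 := mul_le_of_le_one_right
      (mul_nonneg (norm_nonneg (trigPoly w x)) (norm_nonneg (trigPoly v x))) (hg1 x)
    nlinarith [sq_nonneg (‖trigPoly w x‖ - ‖trigPoly v x‖)]
  rw [one_mul]
  exact le_of_sq_le_sq (by linarith) (norm_nonneg _)

/-- The `L¹` norm of the Laurent polynomial of a functional is at most the norm of the
functional. -/
theorem integral_norm_laurent_le {Θ : StrongDual ℂ (Toep n)} (hΘ : IsSelfAdjointFunctional Θ) :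
    ∫ x, ‖laurent Θ x‖ ∂haarAddCircle ≤ ‖Θ‖ := by
  -- The sign of the real-valued Laurent polynomial is the symbol that attains its L¹ norm.
  set g : S1 → ℂ := fun x => if 0 ≤ (laurent Θ x).re then 1 else -1 with hgdef
  have hmeas : Measurable g :=
    Measurable.ite (measurableSet_le measurable_const
      (Complex.measurable_re.comp (continuous_laurent Θ).measurable))
      measurable_const measurable_const
  have hg1 : ∀ x, ‖g x‖ ≤ 1 := by
    intro x
    simp only [hgdef]
    split_ifs <;> simp
  have hg : Integrable g haarAddCircle :=
    Integrable.of_bound hmeas.aestronglyMeasurable 1 (Filter.Eventually.of_forall hg1)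
  have h1 : ∀ x, laurent Θ x * g x = (‖laurent Θ x‖ : ℂ) := by
    intro x
    have h2 : laurent Θ x = ((laurent Θ x).re : ℂ) :=
      Complex.ext rfl (by simp [hΘ.laurent_im x])
    simp only [hgdef]
    rw [h2, Complex.norm_real, Complex.ofReal_re, Real.norm_eq_abs]
    split_ifs with h3
    · rw [abs_of_nonneg h3, mul_one]
    · rw [abs_of_neg (not_le.1 h3), mul_neg_one, Complex.ofReal_neg]
  have h2 := map_toep_fourierCoeff Θ hg
  simp only [h1] at h2
  rw [integral_complex_ofReal] at h2
  calc ∫ x, ‖laurent Θ x‖ ∂haarAddCircle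
      = ‖((∫ x, ‖laurent Θ x‖ ∂haarAddCircle : ℝ) : ℂ)‖ := by
        rw [Complex.norm_real, Real.norm_of_nonneg (integral_nonneg fun _ => norm_nonneg _)]
    _ = ‖Θ (toep n (fourierCoeff g))‖ := by rw [h2]
    _ ≤ ‖Θ‖ * ‖toep n (fourierCoeff g)‖ := ContinuousLinearMap.le_opNorm _ _
    _ ≤ ‖Θ‖ := mul_le_of_le_one_right (ContinuousLinearMap.opNorm_nonneg _)
        (norm_toep_fourierCoeff_le hg hg1)

/-! ### The probability measure of a state -/

theorem measurable_density (φ : StrongDual ℂ (Toep n)) :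
    Measurable fun x => ENNReal.ofReal (laurent φ x).re :=
  (Complex.measurable_re.comp (continuous_laurent φ).measurable).ennreal_ofReal

theorem IsState.ofReal_re_laurent {φ : StrongDual ℂ (Toep n)} (hφ : IsState φ) (x : S1) :
    (((laurent φ x).re : ℝ) : ℂ) = laurent φ x :=
  Complex.ext rfl (by simp [hφ.isSelfAdjointFunctional.laurent_im x])

theorem IsState.integral_laurent {φ : StrongDual ℂ (Toep n)} (hφ : IsState φ) :
    ∫ x, (laurent φ x).re ∂haarAddCircle = 1 := by
  have h := map_toep_fourierCoeff φ (integrable_const (1 : ℂ))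
  rw [toep_fourierCoeff_one, hφ.2] at h
  simp only [mul_one] at h
  apply Complex.ofReal_injective
  rw [← integral_complex_ofReal]
  simp only [hφ.ofReal_re_laurent, ← h, Complex.ofReal_one]

theorem integrable_laurent_re (φ : StrongDual ℂ (Toep n)) :
    Integrable (fun x => (laurent φ x).re) (haarAddCircle (T := 2 * Real.pi)) :=
  (Complex.continuous_re.comp (continuous_laurent φ)).integrable_of_hasCompactSupport
      (HasCompactSupport.of_compactSpace _)

theorem IsState.isProbabilityMeasure {φ : StrongDual ℂ (Toep n)} (hφ : IsState φ) :
    IsProbabilityMeasure (circleMeasure φ) := by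
  constructor
  rw [circleMeasure, withDensity_apply _ MeasurableSet.univ, setLIntegral_univ,
    ← ofReal_integral_eq_lintegral_ofReal (integrable_laurent_re φ)
      (Eventually.of_forall fun x => (Complex.nonneg_iff.1 (hφ.laurent_nonneg x)).1),
    hφ.integral_laurent, ENNReal.ofReal_one]

theorem IsState.map_toep_fourierCoeff_ofReal {φ : StrongDual ℂ (Toep n)} (hφ : IsState φ)
    {f : S1 → ℝ} (hf : Integrable (fun x => (f x : ℂ)) haarAddCircle) :
    φ (toep n (fourierCoeff fun x => (f x : ℂ))) = ((∫ x, f x ∂circleMeasure φ : ℝ) : ℂ) := by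
  rw [map_toep_fourierCoeff φ hf, circleMeasure, integral_withDensity_eq_integral_toReal_smul
    (measurable_density φ) (Eventually.of_forall fun _ => ENNReal.ofReal_lt_top),
    ← integral_complex_ofReal]
  congr 1
  ext x
  rw [ENNReal.toReal_ofReal (Complex.nonneg_iff.1 (hφ.laurent_nonneg x)).1, smul_eq_mul,
    Complex.ofReal_mul, hφ.ofReal_re_laurent]

/-! ### Lipschitz functions and the Kantorovich bound -/

theorem fourierCoeff_translate_sub {f : S1 → ℂ} (hf : Continuous f) (h : S1) (c : ℂ) (k : ℤ) :
    fourierCoeff (fun x => c * (f (x + h) - f x)) k = c * (fourier k h - 1) * fourierCoeff f k := by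
  have hint : ∀ g : S1 → ℂ, Continuous g → Integrable g haarAddCircle := fun g hg =>
    hg.integrable_of_hasCompactSupport (HasCompactSupport.of_compactSpace _)
  have h1 : fourierCoeff (fun x => f (x + h)) k = fourier k h * fourierCoeff f k := by
    rw [fourierCoeff, fourierCoeff, ← integral_const_mul,
      ← integral_add_right_eq_self (fun t => fourier k h * (fourier (-k) t • f t)) h]
    congr 1
    ext t
    have h2 : (fourier k h : ℂ) * fourier (-k) h = 1 := by
      rw [← fourier_add, add_neg_cancel, fourier_zero]
    have h3 : (fourier (-k) (t + h) : ℂ) = fourier (-k) t * fourier (-k) h := by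
      simp only [fourier_apply, smul_add, toCircle_add, Circle.coe_mul]
    rw [h3, smul_eq_mul, smul_eq_mul]
    linear_combination (-(fourier (-k) t : ℂ) * f (t + h)) * h2
  have h4 : fourierCoeff (fun x => f (x + h) - f x) k =
      fourierCoeff (fun x => f (x + h)) k - fourierCoeff f k := by
    simp only [fourierCoeff, smul_sub]
    exact integral_sub ((hint _ (by fun_prop)).fourier_smul _) ((hint _ hf).fourier_smul _)
  rw [fourierCoeff.const_mul, h4, h1]
  ring

theorem tendsto_fourier_sub_one (k : ℤ) :
    Tendsto (fun h : ℝ => (h : ℂ)⁻¹ * ((fourier k (h : S1) : ℂ) - 1)) (𝓝[≠] 0)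
      (𝓝 (Complex.I * k)) := by
  have h := (hasDerivAt_fourier (2 * Real.pi) k 0).tendsto_slope_zero
  have h2 : 2 * (Real.pi : ℂ) * Complex.I * k / ((2 * Real.pi : ℝ) : ℂ) *
      fourier k ((0 : ℝ) : S1) = Complex.I * k := by
    have := Complex.ofReal_ne_zero.2 Real.pi_ne_zero
    rw [QuotientAddGroup.mk_zero, fourier_eval_zero]
    push_cast
    field_simp
  rw [h2] at h
  refine h.congr fun x => ?_
  rw [zero_add, QuotientAddGroup.mk_zero, fourier_eval_zero, Complex.real_smul,
    Complex.ofReal_inv]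

/-- No derivative of `f` is needed: difference quotients are bounded by 1, so their compressions are
contractions, and these converge to ∂ of the compression of `f` coefficient by coefficient. -/
theorem norm_comm_toep_fourierCoeff_le {f : S1 → ℝ} (hf : LipschitzWith 1 f) :
    ‖comm (toep n (fourierCoeff fun x => (f x : ℂ)) : Matrix (Fin n) (Fin n) ℂ)‖ ≤ 1 := by
  set F : S1 → ℂ := fun x => (f x : ℂ)
  have hF : Continuous F := Complex.continuous_ofReal.comp hf.continuous
  rw [← norm_del]
  have hdel : del n (toep n (fourierCoeff F)) =
      toep n fun k => Complex.I * k * fourierCoeff F k := by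
    ext i j
    rw [del_apply, toep_apply, toep_apply, mul_assoc]
  have hlim : Tendsto (fun h : ℝ => toep n
      (fourierCoeff fun x => (h : ℂ)⁻¹ * (F (x + (h : S1)) - F x))) (𝓝[≠] 0)
      (𝓝 (del n (toep n (fourierCoeff F)))) := by
    rw [hdel, toep_eq_sum]
    simp only [toep_eq_sum, fourierCoeff_translate_sub hF]
    exact tendsto_finsetSum _ fun k _ =>
      ((tendsto_fourier_sub_one _).mul_const _).smul_const _
  refine le_of_tendsto hlim.norm (Eventually.of_forall fun h => ?_)
  refine norm_toep_fourierCoeff_le (Continuous.integrable_of_hasCompactSupport (by fun_prop)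
    (HasCompactSupport.of_compactSpace _)) fun x => ?_
  have h1 : ‖F (x + (h : S1)) - F x‖ ≤ |h| := by
    rw [← Complex.ofReal_sub, Complex.norm_real, ← dist_eq_norm]
    refine (hf.dist_le_mul _ _).trans ?_
    rw [NNReal.coe_one, one_mul, dist_eq_norm, add_sub_cancel_left]
    exact QuotientAddGroup.norm_mk_le_norm
  rw [norm_mul, norm_inv, Complex.norm_real, Real.norm_eq_abs]
  exact inv_mul_le_one_of_le₀ h1 (abs_nonneg _)

theorem kantorovichDist_le_connesDist {φ ψ : StrongDual ℂ (Toep n)} (hφ : IsState φ)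
    (hψ : IsState ψ) :
    kantorovichDist (circleMeasure φ) (circleMeasure ψ) ≤ connesDist φ ψ := by
  refine iSup₂_le fun f hf => ?_
  have hint : Integrable (fun x => (f x : ℂ)) (haarAddCircle (T := 2 * Real.pi)) :=
    (Complex.continuous_ofReal.comp hf.continuous).integrable_of_hasCompactSupport
      (HasCompactSupport.of_compactSpace _)
  refine le_iSup₂_of_le (toep n (fourierCoeff fun x => (f x : ℂ))) (isHermitian_toep fun k => ?_)
    (le_iSup_of_le (norm_comm_toep_fourierCoeff_le hf) ?_)
  · rw [fourierCoeff, fourierCoeff, Complex.star_def, ← integral_conj]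
    congr 1
    ext x
    rw [smul_eq_mul, smul_eq_mul, map_mul, Complex.conj_ofReal, ← fourier_neg]
  · rw [hφ.map_toep_fourierCoeff_ofReal hint, hψ.map_toep_fourierCoeff_ofReal hint,
      ← Complex.ofReal_sub, Complex.norm_real, Real.norm_eq_abs]

/-! ### Distribution functions and the explicit bound -/

theorem IsState.circleMeasure_real_arc {φ : StrongDual ℂ (Toep n)} (hφ : IsState φ) {x : ℝ}
    (hx : x ∈ Set.Ico 0 (2 * Real.pi)) :
    (circleMeasure φ).real ((fun t : ℝ => (t : S1)) '' Set.Icc 0 x) =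
      (2 * Real.pi)⁻¹ * ∫ t in (0 : ℝ)..x, (laurent φ (t : S1)).re := by
  set S : Set S1 := (fun t : ℝ => (t : S1)) '' Set.Icc 0 x
  have hS : MeasurableSet S :=
    (isCompact_Icc.image (AddCircle.continuous_mk' (2 * Real.pi))).measurableSet
  -- In the fundamental domain (0, 2π] the point 0 of the arc is represented by 2π, which is set
  -- aside as a null set.
  have hmem : ∀ t ∈ Set.Ioc (0 : ℝ) (0 + 2 * Real.pi), t ≠ 2 * Real.pi →
      ((t : S1) ∈ S ↔ t ∈ Set.Ioc 0 x) := by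
    intro t ht ht'
    rw [zero_add] at ht
    have ht2 : t < 2 * Real.pi := lt_of_le_of_ne ht.2 ht'
    constructor
    · rintro ⟨s, hs, hst⟩
      have : s = t := (AddCircle.coe_eq_coe_iff_of_mem_Ico (p := 2 * Real.pi) (a := 0)
        ⟨hs.1, by linarith [hs.2, hx.2]⟩ ⟨ht.1.le, by linarith⟩).1 hst
      exact ⟨ht.1, this ▸ hs.2⟩
    · exact fun h => ⟨t, ⟨h.1.le, h.2⟩, rfl⟩
  have hnn : ∀ y, 0 ≤ (laurent φ y).re := fun y => (Complex.nonneg_iff.1 (hφ.laurent_nonneg y)).1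
  rw [Measure.real, circleMeasure, withDensity_apply _ hS, ← ofReal_integral_eq_lintegral_ofReal
    (integrable_laurent_re φ).integrableOn (Eventually.of_forall hnn),
    ENNReal.toReal_ofReal (integral_nonneg hnn), ← integral_indicator hS, integral_haarAddCircle,
    smul_eq_mul, ← AddCircle.integral_preimage (2 * Real.pi) 0, intervalIntegral.integral_of_le hx.1]
  congr 1
  have h1 : ∫ a in Set.Ioc (0 : ℝ) (0 + 2 * Real.pi), S.indicator (fun y => (laurent φ y).re) a =
      ∫ a in Set.Ioc (0 : ℝ) (0 + 2 * Real.pi),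
        (Set.Ioc 0 x).indicator (fun t : ℝ => (laurent φ (t : S1)).re) a := by
    refine setIntegral_congr_ae measurableSet_Ioc ?_
    filter_upwards [Measure.ae_ne volume (2 * Real.pi)] with t ht' ht
    simp only [Set.indicator, hmem t ht ht']
  rw [h1, setIntegral_indicator measurableSet_Ioc, Set.inter_eq_self_of_subset_right]
  exact Set.Ioc_subset_Ioc_right (by linarith [hx.2])

/-- The sign arises because coefficient k is the value at the diagonal -k, where ∂ acts as -ik,
while d/dx acts as ik. -/
theorem hasDerivAt_laurent (Θ : StrongDual ℂ (Toep n)) (x : ℝ) :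
    HasDerivAt (fun t : ℝ => laurent Θ (t : S1)) (-laurent (delT Θ) (x : S1)) x := by
  have hc : ∀ k : ℤ, coeff (delT Θ) k = -(Complex.I * k) * coeff Θ k := by
    intro k
    have h : del n (diag n (-k)) = (-(Complex.I * k)) • diag n (-k) := by
      ext i j
      rw [del_apply, Submodule.coe_smul, Matrix.smul_apply, smul_eq_mul]
      by_cases hk : (i : ℤ) - j = -k
      · rw [hk]
        push_cast
        ring
      · simp [diag, hk]
    change Θ (del n (diag n (-k))) = _
    rw [h, map_smul]
    rfl
  simp only [laurent]
  rw [← Finset.sum_neg_distrib]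
  refine HasDerivAt.fun_sum fun k _ => ?_
  refine ((hasDerivAt_fourier (2 * Real.pi) k x).const_mul (coeff Θ k)).congr_deriv ?_
  rw [hc]
  have := Complex.ofReal_ne_zero.2 Real.pi_ne_zero
  push_cast
  field_simp

theorem laurent_sub (φ ψ : StrongDual ℂ (Toep n)) (x : S1) :
    laurent (φ - ψ) x = laurent φ x - laurent ψ x := by
  simp only [laurent_eq]
  rfl

theorem laurent_smul_one (hn : 0 < n) (c : ℂ) (x : S1) : laurent (c • one n) x = c := by
  rw [laurent_eq]
  change c * one n (toep n fun k => fourier (-k) x) = c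
  rw [one_apply _ ⟨0, hn⟩, toep_apply, sub_self, neg_zero, fourier_zero, mul_one]

theorem cdfDiff_circleMeasure {φ ψ Θ : StrongDual ℂ (Toep n)} (hφ : IsState φ) (hψ : IsState ψ)
    (h : delT Θ = ψ - φ) {x : ℝ} (hx : x ∈ Set.Ico 0 (2 * Real.pi)) :
    cdfDiff (circleMeasure φ) (circleMeasure ψ) x =
      (2 * Real.pi)⁻¹ * ((laurent Θ (x : S1)).re - (laurent Θ (0 : S1)).re) := by
  have hcont : ∀ φ : StrongDual ℂ (Toep n), Continuous fun t : ℝ => (laurent φ (t : S1)).re :=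
    fun φ => Complex.continuous_re.comp
      ((continuous_laurent φ).comp (AddCircle.continuous_mk' (2 * Real.pi)))
  have hderiv : ∀ t : ℝ, HasDerivAt (fun t : ℝ => (laurent Θ (t : S1)).re)
      ((laurent φ (t : S1)).re - (laurent ψ (t : S1)).re) t := by
    intro t
    have h1 := Complex.reCLM.hasFDerivAt.comp_hasDerivAt t (hasDerivAt_laurent Θ t)
    rw [h, laurent_sub, neg_sub] at h1
    exact h1
  rw [cdfDiff, hφ.circleMeasure_real_arc hx, hψ.circleMeasure_real_arc hx, ← mul_sub,
    ← intervalIntegral.integral_sub ((hcont φ).intervalIntegrable _ _)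
      ((hcont ψ).intervalIntegrable _ _),
    intervalIntegral.integral_eq_sub_of_hasDerivAt (fun t _ => hderiv t)
      (((hcont φ).sub (hcont ψ)).intervalIntegrable _ _)]
  rfl

/-- The shift of α is chosen so that the integrand becomes |Θ - c| / 2π, whose integral is the L¹
norm for normalized Haar measure. -/
theorem integral_cdfDiff_le {φ ψ Θ : StrongDual ℂ (Toep n)} (hn : 0 < n) (hφ : IsState φ)
    (hψ : IsState ψ) (hΘ : IsSelfAdjointFunctional Θ) (h : delT Θ = ψ - φ) (c : ℝ) :
    ∫ x in (0 : ℝ)..(2 * Real.pi), |cdfDiff (circleMeasure φ) (circleMeasure ψ) x -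
      (2 * Real.pi)⁻¹ * (c - (laurent Θ (0 : S1)).re)| ≤ ‖Θ - (c : ℂ) • one n‖ := by
  have hsa := hΘ.sub (isSelfAdjointFunctional_one.ofReal_smul c)
  refine le_trans (le_of_eq ?_) (integral_norm_laurent_le hsa)
  have h2pi : 0 < 2 * Real.pi := Real.two_pi_pos
  rw [integral_haarAddCircle, ← AddCircle.intervalIntegral_preimage (2 * Real.pi) 0, zero_add,
    smul_eq_mul, ← intervalIntegral.integral_const_mul, intervalIntegral.integral_of_le h2pi.le,
    intervalIntegral.integral_of_le h2pi.le]
  refine setIntegral_congr_ae measurableSet_Ioc ?_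
  filter_upwards [Measure.ae_ne volume (2 * Real.pi)] with t ht' ht
  have hre : laurent (Θ - (c : ℂ) • one n) (t : S1) =
      (((laurent Θ (t : S1)).re - c : ℝ) : ℂ) := by
    rw [laurent_sub, laurent_smul_one hn]
    exact Complex.ext (by simp) (by simp [hΘ.laurent_im])
  rw [cdfDiff_circleMeasure hφ hψ h ⟨ht.1.le, lt_of_le_of_ne ht.2 ht'⟩, hre, Complex.norm_real,
    Real.norm_eq_abs, ← mul_sub, abs_mul, abs_of_pos (inv_pos.2 h2pi)]
  congr 2
  ring

theorem delT_sub (Φ Ψ : StrongDual ℂ (Toep n)) : delT (Φ - Ψ) = delT Φ - delT Ψ := rfl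

theorem iInf_integral_cdfDiff_le_connesDist {φ ψ : StrongDual ℂ (Toep n)} (hn : 0 < n)
    (hφ : IsState φ) (hψ : IsState ψ) :
    ENNReal.ofReal (⨅ a : ℝ, ∫ x in (0 : ℝ)..(2 * Real.pi),
      |cdfDiff (circleMeasure φ) (circleMeasure ψ) x - a|) ≤ connesDist φ ψ := by
  obtain ⟨Φ, hΦ, hΦ'⟩ := hφ.exists_primitive
  obtain ⟨Ψ, hΨ, hΨ'⟩ := hψ.exists_primitive
  have h : delT (Ψ - Φ) = ψ - φ := by
    rw [delT_sub, hΦ', hΨ']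
    ext A
    exact sub_sub_sub_cancel_right (ψ A) (φ A) (one n A)
  rw [connesDist_eq hn (hΨ.sub hΦ) h]
  refine ENNReal.ofReal_le_ofReal (le_ciInf fun c => ?_)
  refine (ciInf_le ⟨0, ?_⟩ _).trans (integral_cdfDiff_le hn hφ hψ (hΨ.sub hΦ) h c)
  rintro _ ⟨a, rfl⟩
  exact intervalIntegral.integral_nonneg Real.two_pi_pos.le fun _ _ => abs_nonneg _

end TruncatedCircle

end

theorem mainTheorem5 (n : ℕ) (hn : 0 < n) :
    (∀ φ : StrongDual ℂ (TruncatedCircle.Toep n), TruncatedCircle.IsState φ →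
      (∃ Φ : StrongDual ℂ (TruncatedCircle.Toep n),
        TruncatedCircle.IsSelfAdjointFunctional Φ ∧
        TruncatedCircle.delT Φ = φ - TruncatedCircle.one n) ∧
      (∀ x : TruncatedCircle.S1, 0 ≤ TruncatedCircle.laurent φ x) ∧
      MeasureTheory.IsProbabilityMeasure (TruncatedCircle.circleMeasure φ)) ∧
    (∀ φ ψ : StrongDual ℂ (TruncatedCircle.Toep n),
      TruncatedCircle.IsState φ → TruncatedCircle.IsState ψ →
      (∀ Φ Ψ : StrongDual ℂ (TruncatedCircle.Toep n),
        TruncatedCircle.IsSelfAdjointFunctional Φ →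
        TruncatedCircle.IsSelfAdjointFunctional Ψ →
        TruncatedCircle.delT Ψ - TruncatedCircle.delT Φ = ψ - φ →
        TruncatedCircle.connesDist φ ψ =
          ENNReal.ofReal (⨅ c : ℝ, ‖Ψ - Φ - (c : ℂ) • TruncatedCircle.one n‖)) ∧
      TruncatedCircle.kantorovichDist (TruncatedCircle.circleMeasure φ)
          (TruncatedCircle.circleMeasure ψ) ≤ TruncatedCircle.connesDist φ ψ ∧
      ENNReal.ofReal (⨅ a : ℝ, ∫ x in (0 : ℝ)..(2 * Real.pi),
          |TruncatedCircle.cdfDiff (TruncatedCircle.circleMeasure φ)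
            (TruncatedCircle.circleMeasure ψ) x - a|) ≤ TruncatedCircle.connesDist φ ψ) := by
  refine ⟨fun φ hφ => ⟨hφ.exists_primitive, hφ.laurent_nonneg, hφ.isProbabilityMeasure⟩,
    fun φ ψ hφ hψ => ⟨fun Φ Ψ hΦ hΨ h => ?_,
      TruncatedCircle.kantorovichDist_le_connesDist hφ hψ,
      TruncatedCircle.iInf_integral_cdfDiff_le_connesDist hn hφ hψ⟩⟩
  exact TruncatedCircle.connesDist_eq hn (hΨ.sub hΦ) (by rw [TruncatedCircle.delT_sub, h])
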